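/- A Cantor set is a space homeomorphic to the standard ternary Cantor set. For a map $h : Z \to Z$ put $\mathrm{Per}(Z,h) = \{ n \ge 1 : h^n(z) = z \text{ for some } z \in Z\}$. Let $(X,d)$ be a metric space that is a Cantor set. A continuous map $f$ of $X$ onto itself is called chain mixing if for every $\delta > 0$ and every pair $x, y \in X$ there is an integer $N \ge 1$ such that for every $n \ge N$ there are points $x_0 = x, x_1, \dots, x_n = y$ of $X$ with $d(f(x_i), x_{i+1}) < \delta$ for all $0 \le i < n$. Theorem. Let $X$ and $Y$ be metric spaces that are Cantor sets, let $f : X \to X$ be a continuous surjection that is chain mixing, and let $g : Y \to Y$ be a homeomorphism that is aperiodic, meaning that $g^n \neq \mathrm{id}_Y$ for every $n \ge 1$. Then the following conditions are equivalent: (a) $\mathrm{Per}(Y,g) \subseteq \mathrm{Per}(X,f)$; (b) there is a sequence of homeomorphisms $\psi_k$ from $Y$ onto $X$ $(k = 1, 2, \dots)$ such that $\sup_{x \in X} d\big(\psi_k(g(\psi_k^{-1}(x))), f(x)\big) \to 0$ as $k \to \infty$. -/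

import Mathlib

namespace CantorDyn

/-- A topological space is a Cantor set if it is homeomorphic to the ternary Cantor set. -/
def IsCantor (X : Type*) [TopologicalSpace X] : Prop :=
  Nonempty (X ≃ₜ cantorSet)

/-- The set of all positive integers `n` (not necessarily least periods) such that `f^n` has a
fixed point. -/
def Per {X : Type*} (f : X → X) : Set ℕ :=
  {n | 0 < n ∧ ∃ x : X, f^[n] x = x}

/-- `c 0, …, c l` is a `δ` chain of `f`, of length `l`, from `x` to `y`.
The values of `c` beyond the index `l` play no role. -/
def IsChain {X : Type*} [MetricSpace X] (f : X → X) (δ : ℝ) (x y : X) (l : ℕ) (c : ℕ → X) : Prop :=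
  c 0 = x ∧ c l = y ∧ ∀ i < l, dist (f (c i)) (c (i + 1)) < δ

/-- Chain mixing: for every `δ > 0` and all `x`, `y`, there are `δ` chains from `x` to `y` of every
sufficiently large length. -/
def ChainMixing {X : Type*} [MetricSpace X] (f : X → X) : Prop :=
  ∀ δ : ℝ, 0 < δ → ∀ x y : X, ∃ N : ℕ, 0 < N ∧ ∀ n ≥ N, ∃ c : ℕ → X, IsChain f δ x y n c

/-- `g` is aperiodic if no positive iterate of `g` is the identity mapping. (Individual orbits may
well be periodic.) -/
def Aperiodic {Y : Type*} (g : Y → Y) : Prop :=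
  ¬ ∃ n : ℕ, 0 < n ∧ g^[n] = id

/-- There are homeomorphisms `ψ k` from `Y` onto `X` such that the conjugates
`ψ k ∘ g ∘ (ψ k)⁻¹` converge to `f` uniformly on `X`. -/
def ConjugatesApproximate {X Y : Type*} [MetricSpace X] [TopologicalSpace Y]
    (g : Y → Y) (f : X → X) : Prop :=
  ∃ ψ : ℕ → (Y ≃ₜ X),
    TendstoUniformly (fun (k : ℕ) (x : X) => ψ k (g ((ψ k).symm x))) f Filter.atTop

end CantorDyn

/-!
Periods pass to uniform limits of conjugates by compactness (`ConjugatesApproximate.per_subset`), so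
the point is to find conjugates of `g` close to `f` when `Per g ⊆ Per f`.

Cut `X` into finitely many small clopen cells, and let the cells be the vertices of a directed
graph, with an edge from `a` to `b` when `f` maps some point of `a` into `b`. Suppose that `Y` is
labelled by vertices in a locally constant and surjective way so that the labels of `y` and `g y`
are always joined by an edge. Nonempty clopen subsets of a Cantor set are Cantor sets, so some
homeomorphism `ψ : Y → X` maps each class of labels onto the cell with that label
(`exists_homeo_of_fibers`), and then `ψ ∘ g ∘ ψ⁻¹` is uniformly close to `f`.

Chain mixing of `f` yields an `N` such that any two vertices are joined by a walk of length `N`, and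
a periodic point of `f` yields a closed walk of the same length. The labelling
(`exists_surjective_labelling`) is then built in three stages.

* Points of period at most `N` are labelled by closed walks (`exists_labelling_of_periodic`): near a
  point of least period `p` there is a clopen set whose trace on the set of these points is
  invariant under `g^p` and disjoint from its first `p - 1` images. Extend the labelling to `Y`
  arbitrarily.
* The pairs `(y, g y)` not labelled by an edge now form a compact set of points `y` without periods
  at most `N`. Such a `y` has a clopen neighbourhood `U` for which `U, g U, …, g^N U` are disjoint.
  Keeping the labels on `U` and `g^N U`, and replacing those in between by walks of length `N`, makes
  the pairs inside this tower good and leaves the good pairs good (`exists_reroute`). Hence finitely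
  many such changes make all pairs good (`exists_repair`).
* Aperiodicity provides points without small periods, for any bound. One more rerouting near
  such a point, along walks that visit every vertex, makes the labelling surjective.
-/

open Set Filter Topology

namespace CantorDyn

/-! ### Clopen subsets of the Cantor space -/

/-- Splitting a binary sequence into its first `n` terms and the remaining ones. -/
noncomputable def splitHomeo (n : ℕ) : (ℕ → Bool) ≃ₜ (Fin n → Bool) × (ℕ → Bool) :=
  (Homeomorph.piCongrLeft (Y := fun _ : ℕ => Bool) (finSumNatEquiv n)).symm.trans
    Homeomorph.sumArrowHomeomorphProdArrow

/-- Every neighbourhood of the diagonal contains all pairs of sequences with a sufficiently long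
common prefix. -/
theorem exists_prefix_subset {W : Set ((ℕ → Bool) × (ℕ → Bool))} (hW : IsOpen W)
    (hdiag : ∀ x, (x, x) ∈ W) :
    ∃ n, ∀ x y, (splitHomeo n x).1 = (splitHomeo n y).1 → (x, y) ∈ W := by
  have hopen : ∀ n : ℕ, IsOpen {z : (ℕ → Bool) × (ℕ → Bool) | ∃ i < n, z.1 i ≠ z.2 i} := fun n => by
    have : {z : (ℕ → Bool) × (ℕ → Bool) | ∃ i < n, z.1 i ≠ z.2 i} =
        ⋃ i ∈ Finset.range n, {z | z.1 i ≠ z.2 i} := by ext; simp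
    rw [this]
    exact isOpen_biUnion fun i _ => isOpen_ne_fun (by fun_prop) (by fun_prop)
  have hcover : Wᶜ ⊆ ⋃ n : ℕ, {z : (ℕ → Bool) × (ℕ → Bool) | ∃ i < n, z.1 i ≠ z.2 i} := by
    rintro ⟨x, y⟩ hxy
    have hne : x ≠ y := fun h => hxy (h ▸ hdiag x)
    obtain ⟨i, hi⟩ := Function.ne_iff.1 hne
    exact mem_iUnion.2 ⟨i + 1, i, Nat.lt_succ_self i, hi⟩
  have hmono : Monotone fun n : ℕ => {z : (ℕ → Bool) × (ℕ → Bool) | ∃ i < n, z.1 i ≠ z.2 i} :=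
    fun a b hab z ⟨i, hi, h⟩ => ⟨i, hi.trans_le hab, h⟩
  obtain ⟨n, hn⟩ :=
    hW.isClosed_compl.isCompact.elim_directed_cover _ hopen hcover hmono.directed_le
  refine ⟨n, fun x y hxy => ?_⟩
  by_contra hmem
  obtain ⟨i, hi, hne⟩ := hn hmem
  exact hne (congrFun hxy ⟨i, hi⟩)

theorem nonempty_fin_prod_homeo (k : ℕ) :
    Nonempty (Fin (k + 1) × (ℕ → Bool) ≃ₜ (ℕ → Bool)) := by
  induction k with
  | zero => exact ⟨Homeomorph.uniqueProd (Fin 1) _⟩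
  | succ k ih =>
    obtain ⟨h⟩ := ih
    have e₁ : Fin (k + 1 + 1) ≃ₜ Fin (k + 1) ⊕ Fin 1 := finSumFinEquiv.symm.toHomeomorphOfDiscrete
    have e₂ : Fin 1 ⊕ Fin 1 ≃ₜ (Fin 1 → Bool) :=
      (Fintype.equivOfCardEq (by simp)).toHomeomorphOfDiscrete
    have u : Fin 1 × (ℕ → Bool) ≃ₜ (ℕ → Bool) := Homeomorph.uniqueProd _ _
    exact ⟨(e₁.prodCongr (.refl _)).trans <| Homeomorph.sumProdDistrib.trans <|
      (h.sumCongr u).trans <| (u.symm.sumCongr u.symm).trans <|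
      Homeomorph.sumProdDistrib.symm.trans <| (e₂.prodCongr (.refl _)).trans (splitHomeo 1).symm⟩

theorem nonempty_homeo_of_isClopen {K : Set (ℕ → Bool)} (hK : IsClopen K) (hne : K.Nonempty) :
    Nonempty (K ≃ₜ (ℕ → Bool)) := by
  have hopen : IsOpen ((K ×ˢ K) ∪ (Kᶜ ×ˢ Kᶜ)) :=
    (hK.isOpen.prod hK.isOpen).union (hK.compl.isOpen.prod hK.compl.isOpen)
  obtain ⟨n, hn⟩ := exists_prefix_subset hopen fun x => by
    by_cases hx : x ∈ K <;> simp [hx]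
  -- Membership in `K` depends on the first `n` bits only.
  let S : Set (Fin n → Bool) := {s | ∃ x ∈ K, (splitHomeo n x).1 = s}
  have hKS : ∀ x, x ∈ K ↔ splitHomeo n x ∈ S ×ˢ (univ : Set (ℕ → Bool)) := by
    intro x
    simp only [mem_prod, mem_univ, and_true]
    refine ⟨fun hx => ⟨x, hx, rfl⟩, fun ⟨y, hy, hxy⟩ => ?_⟩
    rcases hn y x hxy with h | h
    · exact h.2
    · exact absurd hy h.1
  have e₁ : K ≃ₜ ↥(S ×ˢ (univ : Set (ℕ → Bool))) := (splitHomeo n).subtype hKS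
  obtain ⟨x, hx⟩ := hne
  have : Nonempty S := ⟨⟨_, x, hx, rfl⟩⟩
  obtain ⟨k, hk⟩ := Nat.exists_eq_succ_of_ne_zero (Nat.card_pos (α := S)).ne'
  have e₂ : S ≃ₜ Fin (k + 1) :=
    ((Finite.equivFin S).trans (finCongr hk)).toHomeomorphOfDiscrete
  obtain ⟨e₃⟩ := nonempty_fin_prod_homeo k
  exact ⟨e₁.trans <| (Homeomorph.Set.prod _ _).trans <|
    (e₂.prodCongr (Homeomorph.Set.univ _)).trans e₃⟩

theorem IsCantor.nonempty_homeo {X : Type*} [TopologicalSpace X] (hX : IsCantor X) :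
    Nonempty (X ≃ₜ (ℕ → Bool)) :=
  hX.map fun h => h.trans cantorSetHomeomorphNatToBool

theorem IsCantor.nonempty_homeo_of_isClopen {X : Type*} [TopologicalSpace X] (hX : IsCantor X)
    {K : Set X} (hK : IsClopen K) (hne : K.Nonempty) : Nonempty (K ≃ₜ (ℕ → Bool)) := by
  obtain ⟨h⟩ := hX.nonempty_homeo
  obtain ⟨e⟩ := CantorDyn.nonempty_homeo_of_isClopen (K := h '' K)
    ⟨h.isClosedMap _ hK.isClosed, h.isOpenMap _ hK.isOpen⟩ (hne.image h)
  exact ⟨(h.image K).trans e⟩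

/-- A locally constant map to a finite set exhibits a compact Hausdorff space as the disjoint
union of its fibres. -/
noncomputable def sigmaFiberHomeo {X V : Type*} [TopologicalSpace X] [CompactSpace X] [T2Space X]
    [Finite V] {q : X → V} (hq : IsLocallyConstant q) : (Σ v, {x // q x = v}) ≃ₜ X :=
  have : ∀ v, CompactSpace {x // q x = v} := fun v =>
    isCompact_iff_compactSpace.1 (hq.isClosed_fiber v).isCompact
  Continuous.homeoOfEquivCompactToT2 (f := Equiv.sigmaFiberEquiv q)
    (continuous_sigma fun _ => continuous_subtype_val)

/-- Finite clopen partitions of two Cantor sets with the same index set are matched by a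
homeomorphism. -/
theorem exists_homeo_of_fibers {X Y V : Type*} [TopologicalSpace X] [CompactSpace X] [T2Space X]
    [TopologicalSpace Y] [CompactSpace Y] [T2Space Y] [Finite V]
    (hX : IsCantor X) (hY : IsCantor Y) {q : X → V} (hq : IsLocallyConstant q)
    (hqs : Function.Surjective q) {p : Y → V} (hp : IsLocallyConstant p)
    (hps : Function.Surjective p) : ∃ ψ : Y ≃ₜ X, ∀ y, q (ψ y) = p y := by
  have key : ∀ v, Nonempty ({y // p y = v} ≃ₜ {x // q x = v}) := fun v => by
    obtain ⟨a⟩ := hX.nonempty_homeo_of_isClopen (hq.isClopen_fiber v) (hqs v)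
    obtain ⟨b⟩ := hY.nonempty_homeo_of_isClopen (hp.isClopen_fiber v) (hps v)
    exact ⟨b.trans a.symm⟩
  let e := fun v => (key v).some
  have hcont : Continuous (Equiv.sigmaCongrRight fun v => (e v).toEquiv) :=
    continuous_sigma fun v => continuous_sigmaMk.comp (e v).continuous
  have hcont' : Continuous (Equiv.sigmaCongrRight fun v => (e v).toEquiv).symm :=
    continuous_sigma fun v => continuous_sigmaMk.comp (e v).symm.continuous
  let s : (Σ v, {y // p y = v}) ≃ₜ (Σ v, {x // q x = v}) :=
    { Equiv.sigmaCongrRight fun v => (e v).toEquiv with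
      continuous_toFun := hcont
      continuous_invFun := hcont' }
  refine ⟨(sigmaFiberHomeo hp).symm.trans (s.trans (sigmaFiberHomeo hq)), fun y => ?_⟩
  exact (e (p y) ⟨y, rfl⟩).2

/-! ### Locally constant maps -/

theorem isLocallyConstant_ite {Y V : Type*} [TopologicalSpace Y] {T : Set Y} (hT : IsClopen T)
    [DecidablePred (· ∈ T)] {φ π : Y → V} (hφ : IsLocallyConstant φ) (hπ : IsLocallyConstant π) :
    IsLocallyConstant fun y => if y ∈ T then φ y else π y := by
  rw [IsLocallyConstant.iff_eventually_eq]
  intro x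
  by_cases hx : x ∈ T
  · filter_upwards [hT.isOpen.mem_nhds hx, hφ.eventually_eq x] with y hy h
    simp [hx, hy, h]
  · filter_upwards [hT.compl.isOpen.mem_nhds hx, hπ.eventually_eq x] with y hy h
    have hy' : y ∉ T := hy
    simp [hx, hy', h]

/-- Redefining a locally constant map on finitely many disjoint clopen sets. -/
theorem exists_patch {Y V : Type*} [TopologicalSpace Y] (A : ℕ → Set Y)
    (hA : ∀ i, IsClopen (A i)) (φ : ℕ → Y → V) (hφ : ∀ i, IsLocallyConstant (φ i))
    {π : Y → V} (hπ : IsLocallyConstant π) (n : ℕ)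
    (hdisj : ∀ i j, i < j → j < n → ∀ y ∈ A i, y ∉ A j) :
    ∃ π' : Y → V, IsLocallyConstant π' ∧ (∀ i < n, ∀ y ∈ A i, π' y = φ i y) ∧
      ∀ y, (∀ i < n, y ∉ A i) → π' y = π y := by
  classical
  induction n with
  | zero => exact ⟨π, hπ, by simp, fun _ _ => rfl⟩
  | succ n ih =>
    obtain ⟨σ, hσ, h₁, h₂⟩ := ih fun i j hij hj => hdisj i j hij (by omega)
    refine ⟨fun y => if y ∈ A n then φ n y else σ y, isLocallyConstant_ite (hA n) (hφ n) hσ,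
      fun i hi y hy => ?_, fun y hy => ?_⟩
    · rcases Nat.lt_succ_iff_lt_or_eq.1 hi with h | rfl
      · simp [hdisj i n h (Nat.lt_succ_self n) y hy, h₁ i h y hy]
      · simp [hy]
    · simp [hy n (Nat.lt_succ_self n), h₂ y fun i hi => hy i (by omega)]

/-! ### Walks in a directed graph -/

/-- `w 0, …, w n` is a walk from `u` to `v` in the directed graph with edge relation `E`. The
values of `w` beyond `n` play no role. -/
def IsWalk {V : Type*} (E : V → V → Prop) (n : ℕ) (u v : V) (w : ℕ → V) : Prop :=
  w 0 = u ∧ w n = v ∧ ∀ i < n, E (w i) (w (i + 1))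

theorem IsWalk.append {V : Type*} {E : V → V → Prop} {m n : ℕ} {u v z : V} {a b : ℕ → V}
    (ha : IsWalk E m u v a) (hb : IsWalk E n v z b) :
    ∃ w, IsWalk E (m + n) u z w ∧ (∀ i ≤ m, w i = a i) ∧ ∀ i, w (m + i) = b i := by
  have h₁ : ∀ i ≤ m, (if i ≤ m then a i else b (i - m)) = a i := fun i hi => by simp [hi]
  have h₂ : ∀ i, (if m + i ≤ m then a (m + i) else b (m + i - m)) = b i := fun i => by
    rcases Nat.eq_zero_or_pos i with rfl | hi
    · simp [ha.2.1, hb.1]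
    · simp [hi.ne']
  refine ⟨fun i => if i ≤ m then a i else b (i - m), ⟨?_, ?_, fun i hi => ?_⟩, h₁, h₂⟩
  · exact (h₁ 0 (Nat.zero_le _)).trans ha.1
  · exact (h₂ n).trans hb.2.1
  · rcases lt_or_ge i m with h | h
    · simpa only [h₁ i h.le, h₁ (i + 1) h] using ha.2.2 i h
    · obtain ⟨j, rfl⟩ := Nat.exists_eq_add_of_le h
      have := hb.2.2 j (by omega)
      rw [← h₂ j, ← h₂ (j + 1)] at this
      exact this

/-- If any two vertices are joined by a walk of length `N`, then for some `M` any two vertices are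
joined by a walk of length `M` that visits every vertex. -/
theorem exists_walk_through_all {V : Type*} [Finite V] {E : V → V → Prop} {N : ℕ}
    (hN : ∀ u v, ∃ w, IsWalk E N u v w) :
    ∃ M, ∀ u v, ∃ w, IsWalk E M u v w ∧ ∀ a, ∃ i ≤ M, w i = a := by
  classical
  have := Fintype.ofFinite V
  suffices H : ∀ s : Finset V, ∃ M, ∀ u v, ∃ w, IsWalk E M u v w ∧ ∀ a ∈ s, ∃ i ≤ M, w i = a by
    obtain ⟨M, hM⟩ := H Finset.univ
    exact ⟨M, fun u v => by simpa using hM u v⟩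
  intro s
  induction s using Finset.induction_on with
  | empty => exact ⟨N, fun u v => by simpa using hN u v⟩
  | insert b s _ ih =>
    obtain ⟨M, hM⟩ := ih
    refine ⟨N + M, fun u v => ?_⟩
    obtain ⟨w₁, h₁⟩ := hN u b
    obtain ⟨w₂, h₂, h₂s⟩ := hM b v
    obtain ⟨w, hw, hl, hr⟩ := h₁.append h₂
    refine ⟨w, hw, fun a ha => ?_⟩
    rcases Finset.mem_insert.1 ha with rfl | ha
    · exact ⟨N, by omega, by rw [hl N le_rfl, h₁.2.1]⟩
    · obtain ⟨i, hi, rfl⟩ := h₂s a ha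
      exact ⟨N + i, by omega, hr i⟩

/-! ### Clopen towers -/

/-- A point that does not return to itself within `n` steps has a clopen neighbourhood that does
not meet any of its first `n` iterates. -/
theorem exists_isClopen_no_return {Y : Type*} [TopologicalSpace Y] [CompactSpace Y] [T2Space Y]
    [TotallyDisconnectedSpace Y] {g : Y → Y} (hg : Continuous g) {x : Y} {n : ℕ}
    (hx : ∀ i, 0 < i → i ≤ n → g^[i] x ≠ x) :
    ∃ U : Set Y, IsClopen U ∧ x ∈ U ∧ ∀ i, 0 < i → i ≤ n → ∀ u ∈ U, g^[i] u ∉ U := by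
  induction n with
  | zero => exact ⟨univ, isClopen_univ, mem_univ x, fun i h₁ h₂ => by omega⟩
  | succ n ih =>
    obtain ⟨U, hU, hxU, hUn⟩ := ih fun i h₁ h₂ => hx i h₁ (by omega)
    obtain ⟨A, hA, hxA, hAsub⟩ := compact_exists_isClopen_in_isOpen
      (isOpen_compl_singleton (x := g^[n + 1] x)) (x := x)
      (by simpa using (hx (n + 1) (by omega) le_rfl).symm)
    have hxA' : g^[n + 1] x ∉ A := fun h => hAsub h rfl
    refine ⟨U ∩ (A \ g^[n + 1] ⁻¹' A), hU.inter (hA.diff (hA.preimage (hg.iterate _))),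
      ⟨hxU, hxA, hxA'⟩, fun i h₁ h₂ u hu hiu => ?_⟩
    rcases Nat.lt_succ_iff_lt_or_eq.1 (Nat.lt_succ_of_le h₂) with h | rfl
    · exact hUn i h₁ (by omega) u hu.1 hiu.1
    · exact hu.2.2 hiu.2.1

section Tower

variable {Y : Type*} [TopologicalSpace Y] (g : Y ≃ₜ Y)

/-- The `i`-th level `g^i U` of the tower over `U`. -/
def level (U : Set Y) (i : ℕ) : Set Y := {y | g.symm^[i] y ∈ U}

variable {g}

theorem iterate_symm_iterate (i : ℕ) (y : Y) : g.symm^[i] (g^[i] y) = y :=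
  Function.LeftInverse.iterate g.symm_apply_apply i y

theorem iterate_iterate_symm (i : ℕ) (y : Y) : g^[i] (g.symm^[i] y) = y :=
  Function.LeftInverse.iterate g.apply_symm_apply i y

theorem isClopen_level {U : Set Y} (hU : IsClopen U) (i : ℕ) : IsClopen (level g U i) :=
  hU.preimage (g.symm.continuous.iterate i)

theorem iterate_mem_level {U : Set Y} {y : Y} (hy : y ∈ U) (i : ℕ) : g^[i] y ∈ level g U i := by
  simpa [level, iterate_symm_iterate] using hy

theorem apply_mem_level_succ {U : Set Y} {y : Y} {i : ℕ} :
    g y ∈ level g U (i + 1) ↔ y ∈ level g U i := by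
  simp [level]

theorem level_disjoint {U : Set Y} {n : ℕ} (hU : ∀ i, 0 < i → i ≤ n → ∀ u ∈ U, g^[i] u ∉ U)
    (i j : ℕ) (hij : i < j) (hj : j < n + 1) (y : Y) (hi : y ∈ level g U i) :
    y ∉ level g U j := by
  intro hjy
  obtain ⟨k, rfl⟩ := Nat.exists_eq_add_of_lt hij
  refine hU (k + 1) (by omega) (by omega) _ hjy ?_
  have : g^[k + 1] (g.symm^[i + k + 1] y) = g.symm^[i] y := by
    rw [show i + k + 1 = (k + 1) + i by omega, Function.iterate_add_apply _ (k + 1) i,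
      iterate_iterate_symm]
  rwa [this]

end Tower

/-! ### Labelling points of the space by vertices of a graph -/

section Labelling

variable {Y V : Type*} [TopologicalSpace Y] {g : Y ≃ₜ Y} {E : V → V → Prop}

/-- Rerouting: along a tower of height `n`, the labels between the two ends of each column are
replaced by a walk of length `n` with the same ends. Pairs `(y, g y)` labelled by an edge keep
that property, and all pairs inside the tower acquire it. -/
theorem exists_reroute {n : ℕ} {U : Set Y} (hUc : IsClopen U)
    (hU : ∀ i, 0 < i → i ≤ n → ∀ u ∈ U, g^[i] u ∉ U) {w : V → V → ℕ → V}
    (hw : ∀ u v, IsWalk E n u v (w u v)) {π : Y → V} (hπ : IsLocallyConstant π) :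
    ∃ π' : Y → V, IsLocallyConstant π' ∧ (∀ y, E (π y) (π (g y)) → E (π' y) (π' (g y))) ∧
      (∀ y ∈ U, ∀ i < n, E (π' (g^[i] y)) (π' (g^[i + 1] y))) ∧
      ∀ y ∈ U, ∀ i ≤ n, π' (g^[i] y) = w (π y) (π (g^[n] y)) i := by
  obtain ⟨π', hπ', hin, hout⟩ := exists_patch (level g U) (isClopen_level hUc)
    (fun i y => w (π (g.symm^[i] y)) (π (g^[n] (g.symm^[i] y))) i)
    (fun i => ((hπ.comp_continuous (g.symm.continuous.iterate i)).prodMk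
      (hπ.comp_continuous ((g.continuous.iterate n).comp (g.symm.continuous.iterate i)))).comp
        fun z => w z.1 z.2 i) hπ (n + 1) (level_disjoint hU)
  have hval : ∀ y ∈ U, ∀ i ≤ n, π' (g^[i] y) = w (π y) (π (g^[n] y)) i := fun y hy i hi => by
    rw [hin i (by omega) _ (iterate_mem_level hy i)]
    simp only [iterate_symm_iterate]
  have hedge : ∀ y ∈ U, ∀ i < n, E (π' (g^[i] y)) (π' (g^[i + 1] y)) := fun y hy i hi => by
    rw [hval y hy i hi.le, hval y hy (i + 1) hi]
    exact (hw _ _).2.2 i hi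
  -- Labels change only at the levels `0 < i < n`, since the walks have the old ends.
  have hsame : ∀ y, (∀ i, 0 < i → i < n → y ∉ level g U i) → π' y = π y := fun y hy => by
    by_cases h0 : y ∈ level g U 0
    · rw [hin 0 (by omega) y h0, (hw _ _).1]
      rfl
    by_cases hn : y ∈ level g U n
    · rw [hin n (by omega) y hn, (hw _ _).2.1, iterate_iterate_symm]
    refine hout y fun i hi hyi => ?_
    rcases Nat.eq_zero_or_pos i with rfl | hpos
    · exact h0 hyi
    rcases Nat.lt_succ_iff_lt_or_eq.1 hi with h | rfl
    · exact hy i hpos h hyi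
    · exact hn hyi
  refine ⟨π', hπ', fun y hy => ?_, hedge, hval⟩
  by_cases hlev : ∃ i < n, y ∈ level g U i
  · obtain ⟨i, hi, hyi⟩ := hlev
    have := hedge _ hyi i hi
    rwa [Function.iterate_succ_apply', iterate_iterate_symm] at this
  · push Not at hlev
    rw [hsame y fun i _ h => hlev i h, hsame (g y) fun i hpos hi hyi => ?_]
    · exact hy
    · obtain ⟨j, rfl⟩ := Nat.exists_eq_succ_of_ne_zero hpos.ne'
      exact hlev j (by omega) (apply_mem_level_succ.1 hyi)

variable [CompactSpace Y] [T2Space Y] [TotallyDisconnectedSpace Y]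

/-- Finitely many reroutings repair all edges over a compact set without points of small
period. -/
theorem exists_repair {n : ℕ} (hn : 0 < n) {w : V → V → ℕ → V}
    (hw : ∀ u v, IsWalk E n u v (w u v)) {S : Set Y} (hS : IsCompact S)
    (hper : ∀ y ∈ S, ∀ i, 0 < i → i ≤ n → g^[i] y ≠ y) {π : Y → V} (hπ : IsLocallyConstant π) :
    ∃ π' : Y → V, IsLocallyConstant π' ∧ (∀ y, E (π y) (π (g y)) → E (π' y) (π' (g y))) ∧
      ∀ y ∈ S, E (π' y) (π' (g y)) := by
  revert π
  refine hS.induction_on (p := fun S => ∀ {π : Y → V}, IsLocallyConstant π →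
    ∃ π' : Y → V, IsLocallyConstant π' ∧ (∀ y, E (π y) (π (g y)) → E (π' y) (π' (g y))) ∧
      ∀ y ∈ S, E (π' y) (π' (g y))) ?_ ?_ ?_ ?_
  · exact fun {π} hπ => ⟨π, hπ, fun _ h => h, fun _ h => h.elim⟩
  · intro s t hst ht π hπ
    obtain ⟨π', h₁, h₂, h₃⟩ := ht hπ
    exact ⟨π', h₁, h₂, fun y hy => h₃ y (hst hy)⟩
  · intro s t hs ht π hπ
    obtain ⟨σ, h₁, h₂, h₃⟩ := hs hπ
    obtain ⟨τ, k₁, k₂, k₃⟩ := ht h₁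
    exact ⟨τ, k₁, fun y hy => k₂ y (h₂ y hy), fun y hy => hy.elim (fun h => k₂ y (h₃ y h)) (k₃ y)⟩
  · intro x hx
    obtain ⟨U, hU, hxU, hUn⟩ := exists_isClopen_no_return g.continuous (hper x hx)
    refine ⟨U, mem_nhdsWithin_of_mem_nhds (hU.isOpen.mem_nhds hxU), fun {π} hπ => ?_⟩
    obtain ⟨π', h₁, h₂, h₃, -⟩ := exists_reroute hU hUn hw hπ
    exact ⟨π', h₁, h₂, fun y hy => h₃ y hy 0 hn⟩

/-- The periodic points of bounded period can be labelled along closed walks. Here `P` is an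
invariant compact set on which the `m`-th iterate is the identity, and near a point of least
period `p` a closed walk of length `p` is followed. -/
theorem exists_labelling_of_periodic [Nonempty V]
    (hE : ∀ n ∈ Per g, ∃ c : ℕ → V, IsWalk E n (c 0) (c 0) c) {P : Set Y} (hP : IsCompact P)
    (hPg : ∀ y, g y ∈ P ↔ y ∈ P) {m : ℕ} (hm : 0 < m) (hPm : ∀ y ∈ P, g^[m] y = y) :
    ∃ π : Y → V, IsLocallyConstant π ∧ ∀ y ∈ P, E (π y) (π (g y)) := by
  classical
  suffices H : ∃ T : Set Y, IsClopen T ∧ P ⊆ T ∧ (∀ y ∈ P, (g y ∈ T ↔ y ∈ T)) ∧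
      ∃ π : Y → V, IsLocallyConstant π ∧ ∀ y ∈ P, y ∈ T → E (π y) (π (g y)) by
    obtain ⟨T, -, hPT, -, π, hπ, h⟩ := H
    exact ⟨π, hπ, fun y hy => h y hy (hPT hy)⟩
  refine hP.induction_on (p := fun S => ∃ T : Set Y, IsClopen T ∧ S ⊆ T ∧
    (∀ y ∈ P, (g y ∈ T ↔ y ∈ T)) ∧
      ∃ π : Y → V, IsLocallyConstant π ∧ ∀ y ∈ P, y ∈ T → E (π y) (π (g y))) ?_ ?_ ?_ ?_
  · exact ⟨∅, isClopen_empty, subset_rfl, by simp, Function.const Y (Classical.arbitrary V),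
      .const _, by simp⟩
  · rintro s t hst ⟨T, h₁, h₂, h₃⟩
    exact ⟨T, h₁, hst.trans h₂, h₃⟩
  · rintro s t ⟨T, h₁, h₂, h₃, π, h₄, h₅⟩ ⟨T', k₁, k₂, k₃, π', k₄, k₅⟩
    refine ⟨T ∪ T', h₁.union k₁, union_subset_union h₂ k₂,
      fun y hy => or_congr (h₃ y hy) (k₃ y hy), fun y => if y ∈ T then π y else π' y,
      isLocallyConstant_ite h₁ h₄ k₄, fun y hy hyT => ?_⟩
    by_cases h : y ∈ T
    · simpa [h, h₃ y hy] using h₅ y hy h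
    · simpa [h, h₃ y hy] using k₅ y hy (hyT.resolve_left h)
  · intro x hx
    have hxper : x ∈ Function.periodicPts g := ⟨m, hm, hPm x hx⟩
    have hpos : 0 < Function.minimalPeriod g x := Function.minimalPeriod_pos_of_mem_periodicPts hxper
    obtain ⟨p, hp⟩ := Nat.exists_eq_succ_of_ne_zero hpos.ne'
    have hxp : g^[p + 1] x = x := by
      have := Function.iterate_minimalPeriod (f := g) (x := x)
      rwa [hp] at this
    obtain ⟨c, -, hc, hcE⟩ := hE (p + 1) ⟨by omega, x, hxp⟩
    obtain ⟨U, hU, hxU, hUn⟩ := exists_isClopen_no_return g.continuous (x := x) (n := p)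
      fun i h₁ h₂ h => Function.not_isPeriodicPt_of_pos_of_lt_minimalPeriod h₁.ne' (by omega) h
    -- Since `h` has finite order on `P`, the trace on `P` of the set `W` below is `h`-invariant.
    set h : Y → Y := g^[p + 1] with hh
    have hcont : Continuous h := g.continuous.iterate _
    have hPh : ∀ y ∈ P, h^[m] y = y := fun y hy => by
      rw [hh, ← Function.iterate_mul, mul_comm, Function.iterate_mul]
      exact Function.iterate_fixed (hPm y hy) _
    let W : Set Y := {y | ∀ j < m, h^[j] y ∈ U}
    have hWc : IsClopen W := by
      have : W = ⋂ j ∈ Finset.range m, h^[j] ⁻¹' U := by ext; simp [W]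
      rw [this]
      exact isClopen_biInter_finset fun j _ => hU.preimage (hcont.iterate j)
    have hWall : ∀ y ∈ P, y ∈ W → ∀ j, h^[j] y ∈ U := fun y hy hyW j => by
      have hper : Function.IsPeriodicPt h m y := hPh y hy
      rw [← hper.iterate_mod_apply j]
      exact hyW _ (Nat.mod_lt _ hm)
    have hPit : ∀ k, ∀ y ∈ P, g^[k] y ∈ P := fun k => by
      induction k with
      | zero => exact fun y hy => hy
      | succ k ih => exact fun y hy => ih _ ((hPg y).2 hy)
    have hPit' : ∀ k, ∀ y ∈ P, g.symm^[k] y ∈ P := fun k => by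
      induction k with
      | zero => exact fun y hy => hy
      | succ k ih => exact fun y hy => ih _ ((hPg _).1 (by simpa using hy))
    have hWh : ∀ y ∈ P, (h y ∈ W ↔ y ∈ W) := fun y hy => by
      refine ⟨fun hyW j _ => ?_, fun hyW j _ => hWall y hy hyW (j + 1)⟩
      have := hWall (h y) (hPit _ y hy) hyW (j + (m - 1))
      rw [← Function.iterate_succ_apply, show (j + (m - 1)).succ = j + m by omega,
        Function.iterate_add_apply, hPh y hy] at this
      exact this
    have hWU : W ⊆ U := fun y hy => hy 0 hm
    have hxW : x ∈ W := fun j _ => by rwa [Function.iterate_fixed hxp]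
    obtain ⟨π, hπ, hin, -⟩ := exists_patch (level g W) (isClopen_level hWc)
      (fun i _ => c i) (fun i => .const _) (.const (c 0)) (p + 1)
      (level_disjoint fun i h₁ h₂ u hu hiu => hUn i h₁ h₂ u (hWU hu) (hWU hiu))
    -- The top level of the tower over `W` is mapped to its base.
    have htop : ∀ y ∈ P, (g y ∈ level g W 0 ↔ y ∈ level g W p) := fun y hy => by
      have := hWh _ (hPit' p y hy)
      rwa [hh, Function.iterate_succ_apply', iterate_iterate_symm] at this
    have hTc : IsClopen (⋃ i ∈ Finset.range (p + 1), level g W i) :=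
      isClopen_biUnion_finset fun i _ => isClopen_level hWc i
    have hT : ∀ y, (y ∈ ⋃ i ∈ Finset.range (p + 1), level g W i) ↔
        ∃ i < p + 1, y ∈ level g W i := fun y => by
      simp only [mem_iUnion, Finset.mem_range, exists_prop]
    have hxT : x ∈ ⋃ i ∈ Finset.range (p + 1), level g W i :=
      (hT x).2 ⟨0, by omega, hxW⟩
    refine ⟨⋃ i ∈ Finset.range (p + 1), level g W i,
      mem_nhdsWithin_of_mem_nhds (hTc.isOpen.mem_nhds hxT), _, hTc, subset_rfl,
      fun y hy => ?_, π, hπ, fun y hy hyT => ?_⟩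
    · rw [hT, hT]
      constructor
      · rintro ⟨_ | i, hi, hyi⟩
        · exact ⟨p, by omega, (htop y hy).1 hyi⟩
        · exact ⟨i, by omega, apply_mem_level_succ.1 hyi⟩
      · rintro ⟨i, hi, hyi⟩
        rcases Nat.lt_succ_iff_lt_or_eq.1 hi with h | rfl
        · exact ⟨i + 1, by omega, apply_mem_level_succ.2 hyi⟩
        · exact ⟨0, by omega, (htop y hy).2 hyi⟩
    · obtain ⟨i, hi, hyi⟩ := (hT y).1 hyT
      rw [hin i hi y hyi]
      rcases Nat.lt_succ_iff_lt_or_eq.1 hi with h | rfl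
      · rw [hin (i + 1) (by omega) _ (apply_mem_level_succ.2 hyi)]
        exact hcE i hi
      · rw [hin 0 (by omega) _ ((htop y hy).2 hyi), ← hc]
        exact hcE i hi

/-- An aperiodic homeomorphism of a compact totally disconnected Hausdorff space admits a locally
constant surjective labelling by the vertices of a mixing finite graph, carrying orbits to walks,
as soon as the graph has closed walks of all the lengths in `Per g`. -/
theorem exists_surjective_labelling [Finite V] [Nonempty V] (hg : Aperiodic g)
    (hE : ∀ n ∈ Per g, ∃ c : ℕ → V, IsWalk E n (c 0) (c 0) c) {N : ℕ} (hN : 0 < N)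
    (hmix : ∀ u v, ∃ w, IsWalk E N u v w) :
    ∃ π : Y → V, IsLocallyConstant π ∧ Function.Surjective π ∧ ∀ y, E (π y) (π (g y)) := by
  have hfix : ∀ {i n : ℕ} {y : Y}, 0 < i → i ≤ n → g^[i] y = y → g^[n.factorial] y = y :=
    fun hi hin hy => by
      obtain ⟨k, hk⟩ := Nat.dvd_factorial hi hin
      rw [hk, Function.iterate_mul]
      exact Function.iterate_fixed hy k
  let P : Set Y := {y | ∃ i ∈ Finset.Icc 1 N, g^[i] y = y}
  have hPc : IsClosed P := by
    have : P = ⋃ i ∈ Finset.Icc 1 N, {y | g^[i] y = y} := by ext; simp [P]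
    rw [this]
    exact isClosed_biUnion_finset fun i _ =>
      isClosed_eq (g.continuous.iterate i) continuous_id
  obtain ⟨π₀, h₀, h₀P⟩ := exists_labelling_of_periodic hE hPc.isCompact
    (fun y => exists_congr fun i => and_congr_right fun _ => by
      rw [← Function.iterate_succ_apply, Function.iterate_succ_apply', g.injective.eq_iff])
    N.factorial_pos (fun y ⟨i, hi, hy⟩ =>
      hfix (Finset.mem_Icc.1 hi).1 (Finset.mem_Icc.1 hi).2 hy)
  have hbad : IsClosed {y | ¬ E (π₀ y) (π₀ (g y))} :=
    ⟨by
      have := (h₀.prodMk (h₀.comp_continuous g.continuous)) {z | E z.1 z.2}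
      simpa [compl_ofPred] using this⟩
  choose w hw using hmix
  obtain ⟨π₁, h₁, h₁E, h₁B⟩ := exists_repair hN hw hbad.isCompact
    (fun y hy i h h' hi => hy (h₀P y ⟨i, Finset.mem_Icc.2 ⟨h, h'⟩, hi⟩)) h₀
  have h₁all : ∀ y, E (π₁ y) (π₁ (g y)) := fun y => by
    by_cases hy : E (π₀ y) (π₀ (g y))
    · exact h₁E y hy
    · exact h₁B y hy
  -- One more rerouting, along a walk through all vertices, makes the labelling surjective.
  obtain ⟨M, hM⟩ := exists_walk_through_all fun u v => ⟨w u v, hw u v⟩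
  choose w' hw' hall using hM
  obtain ⟨x, hx⟩ : ∃ x, g^[M.factorial] x ≠ x := by
    by_contra! h
    exact hg ⟨_, M.factorial_pos, funext h⟩
  obtain ⟨U, hU, hxU, hUn⟩ := exists_isClopen_no_return g.continuous (x := x) (n := M)
    fun i h h' hi => hx (hfix h h' hi)
  obtain ⟨π₂, h₂, h₂E, -, h₂w⟩ := exists_reroute hU hUn hw' h₁
  refine ⟨π₂, h₂, fun a => ?_, fun y => h₂E y (h₁all y)⟩
  obtain ⟨i, hi, hia⟩ := hall (π₁ x) (π₁ (g^[M] x)) a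
  exact ⟨g^[i] x, (h₂w x hxU i hi).trans hia⟩

end Labelling

/-! ### Conjugates close to a chain mixing map -/

section Approximation

variable {X : Type*} [MetricSpace X]

/-- A Cantor set has partitions into finitely many clopen sets of arbitrarily small diameter. -/
theorem IsCantor.exists_partition (hX : IsCantor X) {ε : ℝ} (hε : 0 < ε) :
    ∃ (n : ℕ) (q : X → Fin n → Bool), IsLocallyConstant q ∧ Function.Surjective q ∧
      ∀ x y, q x = q y → dist x y < ε := by
  obtain ⟨h⟩ := hX.nonempty_homeo
  obtain ⟨n, hn⟩ := exists_prefix_subset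
    (W := {z | dist (h.symm z.1) (h.symm z.2) < ε})
    (isOpen_lt (by fun_prop) continuous_const) (fun x => by simpa using hε)
  refine ⟨n, fun x => (splitHomeo n (h x)).1, ?_, ?_, fun x y hxy => ?_⟩
  · rw [IsLocallyConstant.iff_continuous]
    fun_prop
  · exact fun s => ⟨h.symm ((splitHomeo n).symm (s, fun _ => false)), by simp⟩
  · simpa using hn _ _ hxy

variable [CompactSpace X]

/-- A locally constant map on a compact metric space is constant at small scales. -/
theorem exists_dist_lt_imp_eq {V : Type*} {q : X → V} (hq : IsLocallyConstant q) :
    ∃ δ > 0, ∀ x y, dist x y < δ → q x = q y := by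
  obtain ⟨δ, hδ, h⟩ := lebesgue_number_lemma_of_metric (isCompact_univ (X := X))
    (c := fun v => {x | q x = v}) (fun v => hq.isOpen_fiber v)
    (fun x _ => mem_iUnion.2 ⟨q x, rfl⟩)
  refine ⟨δ, hδ, fun x y hxy => ?_⟩
  obtain ⟨v, hv⟩ := h x (mem_univ x)
  have hx : q x = v := hv (Metric.mem_ball_self hδ)
  have hy : q y = v := hv (by rwa [Metric.mem_ball, dist_comm])
  rw [hx, hy]

theorem ChainMixing.exists_walk {f : X → X} (hf : ChainMixing f) {V : Type*} [Finite V]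
    {q : X → V} (hq : IsLocallyConstant q) (hqs : Function.Surjective q) :
    ∃ N > 0, ∀ u v, ∃ w, IsWalk (fun a b => ∃ x, q x = a ∧ q (f x) = b) N u v w := by
  have := Fintype.ofFinite V
  obtain ⟨δ, hδ, hqδ⟩ := exists_dist_lt_imp_eq hq
  have key : ∀ u v, ∃ N : ℕ, ∀ n ≥ N,
      ∃ w, IsWalk (fun a b => ∃ x, q x = a ∧ q (f x) = b) n u v w := fun u v => by
    obtain ⟨x, rfl⟩ := hqs u
    obtain ⟨y, rfl⟩ := hqs v
    obtain ⟨N, -, hN⟩ := hf δ hδ x y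
    refine ⟨N, fun n hn => ?_⟩
    obtain ⟨c, rfl, rfl, hc⟩ := hN n hn
    exact ⟨q ∘ c, rfl, rfl, fun i hi => ⟨c i, rfl, hqδ _ _ (hc i hi)⟩⟩
  choose N hN using key
  refine ⟨(Finset.univ.sup fun z : V × V => N z.1 z.2) + 1, by omega, fun u v => hN u v _ ?_⟩
  exact (Finset.le_sup (f := fun z : V × V => N z.1 z.2) (Finset.mem_univ (u, v))).trans
    (Nat.le_succ _)

variable {Y : Type*} [TopologicalSpace Y] [CompactSpace Y] [T2Space Y]
  [TotallyDisconnectedSpace Y]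

theorem exists_conjugate_dist_lt (hX : IsCantor X) (hY : IsCantor Y) {f : X → X}
    (hf : Continuous f) (hmix : ChainMixing f) {g : Y ≃ₜ Y} (hg : Aperiodic g)
    (hper : Per g ⊆ Per f) {ε : ℝ} (hε : 0 < ε) :
    ∃ ψ : Y ≃ₜ X, ∀ x, dist (f x) (ψ (g (ψ.symm x))) < ε := by
  obtain ⟨δ, hδ, hfδ⟩ := Metric.uniformContinuous_iff.1
    (CompactSpace.uniformContinuous_of_continuous hf) (ε / 2) (half_pos hε)
  obtain ⟨n, q, hq, hqs, hqd⟩ := hX.exists_partition (lt_min hδ (half_pos hε))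
  obtain ⟨N, hN, hwalk⟩ := hmix.exists_walk hq hqs
  have hclosed : ∀ k ∈ Per g, ∃ c : ℕ → Fin n → Bool,
      IsWalk (fun a b => ∃ x, q x = a ∧ q (f x) = b) k (c 0) (c 0) c := fun k hk => by
    obtain ⟨-, z, hz⟩ := hper hk
    refine ⟨fun i => q (f^[i] z), rfl, congrArg q hz, fun i _ => ⟨f^[i] z, rfl, ?_⟩⟩
    exact congrArg q (Function.iterate_succ_apply' f i z).symm
  obtain ⟨p, hp, hps, hpE⟩ := exists_surjective_labelling hg hclosed hN hwalk
  obtain ⟨ψ, hψ⟩ := exists_homeo_of_fibers hX hY hq hqs hp hps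
  refine ⟨ψ, fun x => ?_⟩
  obtain ⟨y, rfl⟩ := ψ.surjective x
  rw [ψ.symm_apply_apply]
  -- Some point `x'` of the cell of `ψ y` is mapped by `f` into the cell of `ψ (g y)`.
  obtain ⟨x', h₁, h₂⟩ := hpE y
  have d₁ : dist (f (ψ y)) (f x') < ε / 2 :=
    hfδ ((hqd _ _ ((hψ y).trans h₁.symm)).trans_le (min_le_left _ _))
  have d₂ : dist (f x') (ψ (g y)) < ε / 2 :=
    (hqd _ _ (h₂.trans (hψ (g y)).symm)).trans_le (min_le_right _ _)
  linarith [dist_triangle (f (ψ y)) (f x') (ψ (g y))]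

/-- Periods pass to uniform limits of conjugates. -/
theorem ConjugatesApproximate.per_subset {Y : Type*} [TopologicalSpace Y] {f : X → X}
    (hf : Continuous f) {g : Y → Y} (h : ConjugatesApproximate g f) : Per g ⊆ Per f := by
  rintro n ⟨hn, y, hy⟩
  obtain ⟨ψ, hψ⟩ := h
  have huc := CompactSpace.uniformContinuous_of_continuous hf
  rw [Metric.tendstoUniformly_iff] at hψ
  have hiter : ∀ i, ∀ ε > 0, ∀ᶠ k in atTop, dist (f^[i] (ψ k y)) (ψ k (g^[i] y)) < ε := fun i => by
    induction i with
    | zero => exact fun ε hε => Eventually.of_forall fun k => by simpa using hε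
    | succ i ih =>
      intro ε hε
      obtain ⟨δ, hδ, hfδ⟩ := Metric.uniformContinuous_iff.1 huc (ε / 2) (half_pos hε)
      filter_upwards [ih δ hδ, hψ (ε / 2) (half_pos hε)] with k h₁ h₂
      have d₁ := hfδ h₁
      have d₂ := h₂ (ψ k (g^[i] y))
      rw [(ψ k).symm_apply_apply] at d₂
      rw [Function.iterate_succ_apply', Function.iterate_succ_apply']
      linarith [dist_triangle (f (f^[i] (ψ k y))) (f (ψ k (g^[i] y))) (ψ k (g (g^[i] y)))]
  obtain ⟨x, -, hx⟩ := (isCompact_univ (X := X)).exists_isMinOn ⟨ψ 0 y, mem_univ _⟩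
    (f := fun x => dist (f^[n] x) x) ((hf.iterate n).dist continuous_id).continuousOn
  refine ⟨hn, x, dist_le_zero.1 (le_of_forall_pos_lt_add fun ε hε => ?_)⟩
  obtain ⟨k, hk⟩ := (hiter n ε hε).exists
  rw [hy] at hk
  simpa using (hx (mem_univ (ψ k y))).trans_lt hk

end Approximation

end CantorDyn

theorem theorem1p1 {X Y : Type*} [MetricSpace X] [MetricSpace Y]
    (hX : CantorDyn.IsCantor X) (hY : CantorDyn.IsCantor Y)
    (f : X → X) (hf_cont : Continuous f) (hf_surj : Function.Surjective f)
    (hf_mix : CantorDyn.ChainMixing f)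
    (g : Y ≃ₜ Y) (hg : CantorDyn.Aperiodic g) :
    CantorDyn.Per g ⊆ CantorDyn.Per f ↔ CantorDyn.ConjugatesApproximate g f := by
  obtain ⟨a⟩ := hX.nonempty_homeo
  obtain ⟨b⟩ := hY.nonempty_homeo
  have : CompactSpace X := a.symm.compactSpace
  have : CompactSpace Y := b.symm.compactSpace
  have : TotallyDisconnectedSpace Y := b.symm.totallyDisconnectedSpace
  refine ⟨fun h => ?_, fun h => h.per_subset hf_cont⟩
  choose ψ hψ using fun k : ℕ => CantorDyn.exists_conjugate_dist_lt hX hY hf_cont hf_mix hg h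
    (Nat.one_div_pos_of_nat (α := ℝ) (n := k))
  refine ⟨ψ, Metric.tendstoUniformly_iff.2 fun ε hε => ?_⟩
  filter_upwards [tendsto_one_div_add_atTop_nhds_zero_nat.eventually (gt_mem_nhds hε)] with k hk x
  exact (hψ k x).trans hk
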